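/- Let $V$ be a finite-dimensional real vector space with a non-degenerate quadratic form $Q$, and let $\mathrm{Cl}(V)$ be its real Clifford algebra, with the sign convention $v^2=-Q(v)$ for $v\in V\subset \mathrm{Cl}(V)$. Let $a\mapsto\hat a$ be the grade involution (the algebra automorphism with $\hat v=-v$ for $v\in V$) and $a\mapsto\tilde a$ the reversal (the linear anti-automorphism with $\tilde v=v$ for $v\in V$). The Lipschitz group $\Gamma(V)$ is the set of invertible $a\in\mathrm{Cl}(V)$ such that $a x\hat a^{-1}\in V$ for all $x\in V$. Give $V\oplus\mathbb R^{1,1}$ the quadratic form $\hat Q(v+s e_-+t e_+)=Q(v)-s^2+t^2$, and identify $\mathrm{Cl}(V\oplus\mathbb R^{1,1})$ with $\mathrm{Mat}(2,\mathrm{Cl}(V))$ by the algebra isomorphism extending $$v+s e_-+t e_+\;\longmapsto\;\begin{pmatrix} v & s-t\\ s+t & -v\end{pmatrix}.$$ A matrix $A=\begin{pmatrix} a&b\\ c&d\end{pmatrix}\in\mathrm{Mat}(2,\mathrm{Cl}(V))$ is a Vahlen matrix if it lies in $\Gamma(V\oplus\mathbb R^{1,1})$. Put $\Delta(A)=a\tilde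 d-b\tilde c$ and, for $x\in V$ with $cx+d$ invertible, $Ax=(ax+b)(cx+d)^{-1}$. **Lemma.** Let $A=\begin{pmatrix} a&b\\ c&d\end{pmatrix}$ be a Vahlen matrix. 1. For all $x,y\in V$ such that $cx+d$ and $cy+d$ are invertible, $$Ax-Ay=\Delta(A)\,(y\tilde c+\tilde d)^{-1}(x-y)(cx+d)^{-1}=\Delta(A)\,(x\tilde c+\tilde d)^{-1}(x-y)(cy+d)^{-1}.$$ 2. Let $e_1,\dots,e_n$ be a basis of $V$, with coordinates $x_1,\dots,x_n$, and let $x\in V$ be such that $cx+d$ is invertible. Then $c(x+he_\mu)+d$ is invertible for all sufficiently small real $h$, the product $(x\tilde c+\tilde d)(cx+d)$ is a non-zero real number, and the partial derivative of $x\mapsto Ax$ exists at $x$ and equals $$\frac{\partial (Ax)}{\partial x_\mu}=\Delta(A)\,(x\tilde c+\tilde d)^{-1}e_\mu(cx+d)^{-1}=\frac{\Delta(A)}{(x\tilde c+\tilde d)(cx+d)}\,(cx+d)\,e_\mu\,(cx+d)^{-1}.$$ -/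

import Mathlib

open scoped Topology

noncomputable section

namespace Vahlen

variable {V : Type*} [AddCommGroup V] [Module ℝ V]

/-- The real Clifford algebra `Cl(V)` of `(V, Q)`, with the sign convention `v * v = -Q v`. -/
abbrev Cl (Q : QuadraticForm ℝ V) : Type _ := CliffordAlgebra (-Q)

/-- The inclusion of the vectors, `V → Cl(V)`. -/
abbrev vec (Q : QuadraticForm ℝ V) : V →ₗ[ℝ] Cl Q := CliffordAlgebra.ι (-Q)

/-- The reversal `v₁ ⋯ vₖ ↦ vₖ ⋯ v₁`. -/
abbrev rev {Q : QuadraticForm ℝ V} : Cl Q →ₗ[ℝ] Cl Q := CliffordAlgebra.reverse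

/-- The grade involution on the invertible elements of `Cl(V)`. -/
def gradeInvUnits (Q : QuadraticForm ℝ V) : (Cl Q)ˣ →* (Cl Q)ˣ :=
  Units.map (CliffordAlgebra.involute : Cl Q →ₐ[ℝ] Cl Q).toRingHom.toMonoidHom

/-- The Lipschitz group: the invertible elements `a` for which the twisted adjoint action
`x ↦ a x â⁻¹` maps `V` to `V`, where `â` is the grade involution of `a`. -/
def lipschitz (Q : QuadraticForm ℝ V) : Set (Cl Q)ˣ :=
  {a | ∀ x : V, (a : Cl Q) * vec Q x * ((gradeInvUnits Q a)⁻¹ : (Cl Q)ˣ) ∈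
    LinearMap.range (vec Q)}

/-- The quadratic form `(v, s, t) ↦ Q v - s² + t²` on `V ⊕ ℝ^{1,1}`; the triple `(v, s, t)`
stands for `v + s e₋ + t e₊`. -/
def hatQ (Q : QuadraticForm ℝ V) : QuadraticForm ℝ (V × ℝ × ℝ) :=
  QuadraticMap.prod Q (QuadraticMap.prod (-QuadraticMap.sq) QuadraticMap.sq)

theorem hatQ_apply (Q : QuadraticForm ℝ V) (v : V) (s t : ℝ) :
    hatQ Q (v, s, t) = Q v - s ^ 2 + t ^ 2 := by
  simp [hatQ]
  ring

/-- The Clifford map `j : V ⊕ ℝ^{1,1} → Mat(2, Cl(V))`. -/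
def j (Q : QuadraticForm ℝ V) : (V × ℝ × ℝ) →ₗ[ℝ] Matrix (Fin 2) (Fin 2) (Cl Q) where
  toFun x := !![vec Q x.1, algebraMap ℝ (Cl Q) (x.2.1 - x.2.2);
                algebraMap ℝ (Cl Q) (x.2.1 + x.2.2), -vec Q x.1]
  map_add' x y := by
    ext a b
    fin_cases a <;> fin_cases b <;> simp <;> abel
  map_smul' r x := by
    ext a b
    fin_cases a <;> fin_cases b <;> simp [Algebra.smul_def, mul_sub, mul_add]

theorem j_mul_j (Q : QuadraticForm ℝ V) (x : V × ℝ × ℝ) :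
    j Q x * j Q x = algebraMap ℝ _ ((-hatQ Q) x) := by
  obtain ⟨v, s, t⟩ := x
  have hv : vec Q v * vec Q v = -algebraMap ℝ (Cl Q) (Q v) := by
    simp [vec]
  have hst := Algebra.commutes (A := Cl Q) s (algebraMap ℝ _ t)
  have h1 := Algebra.commutes (A := Cl Q) s (vec Q v)
  have h2 := Algebra.commutes (A := Cl Q) t (vec Q v)
  rw [neg_apply, hatQ_apply]
  ext a b
  fin_cases a <;> fin_cases b <;>
    simp [j, Matrix.mul_apply, Fin.sum_univ_two, Matrix.algebraMap_matrix_apply, hv, pow_two,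
      mul_add, add_mul, mul_sub, sub_mul, hst, h1, h2] <;> abel

/-- The algebra homomorphism `Cl(V ⊕ ℝ^{1,1}) → Mat(2, Cl(V))` extending `j`
(it is an isomorphism). -/
def jHat (Q : QuadraticForm ℝ V) : Cl (hatQ Q) →ₐ[ℝ] Matrix (Fin 2) (Fin 2) (Cl Q) :=
  CliffordAlgebra.lift (-hatQ Q) ⟨j Q, j_mul_j Q⟩

/-- A Vahlen matrix: an element of the Lipschitz group of `V ⊕ ℝ^{1,1}`, viewed as a
`2 × 2` matrix over `Cl(V)`. -/
def IsVahlen (Q : QuadraticForm ℝ V) (A : Matrix (Fin 2) (Fin 2) (Cl Q)) : Prop :=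
  ∃ g ∈ lipschitz (hatQ Q), jHat Q g = A

/-- The pseudo-determinant `a d̃ - b c̃`. -/
def pdet {Q : QuadraticForm ℝ V} (A : Matrix (Fin 2) (Fin 2) (Cl Q)) : Cl Q :=
  A 0 0 * rev (A 1 1) - A 0 1 * rev (A 1 0)

/-- The denominator `c x + d`. -/
def den {Q : QuadraticForm ℝ V} (A : Matrix (Fin 2) (Fin 2) (Cl Q)) (x : V) : Cl Q :=
  A 1 0 * vec Q x + A 1 1

/-- The element `x c̃ + d̃`. -/
def denRev {Q : QuadraticForm ℝ V} (A : Matrix (Fin 2) (Fin 2) (Cl Q)) (x : V) : Cl Q :=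
  vec Q x * rev (A 1 0) + rev (A 1 1)

/-- The action `A x = (a x + b) (c x + d)⁻¹`, meaningful when `c x + d` is invertible. -/
def act {Q : QuadraticForm ℝ V} (A : Matrix (Fin 2) (Fin 2) (Cl Q)) (x : V) : Cl Q :=
  (A 0 0 * vec Q x + A 0 1) * Ring.inverse (den A x)

/-- The usual topology of `Cl(V)` as a real vector space (for finite-dimensional `V`, the unique
Hausdorff vector space topology). -/
instance instTopCl (Q : QuadraticForm ℝ V) : TopologicalSpace (Cl Q) :=
  moduleTopology ℝ (Cl Q)

instance instIsModuleTopologyCl (Q : QuadraticForm ℝ V) : IsModuleTopology ℝ (Cl Q) := ⟨rfl⟩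

end Vahlen

end

/-! A Lipschitz element `g` satisfies `conj g * g = N` with `N` a non-zero real; for matrices,
`matConj A * A = A * matConj A = N`. Entrywise this gives Δ(A) = N and (y c̃ + d̃)(a z + b) - (y ã +
b̃)(c z + d) = N (z - y), whence the difference formulas (`act_sub_act`). The norm is real because
the twisted centre of a nondegenerate Clifford algebra is ℝ: twisted commutators with vectors are
contractions, and an Euler operator shows that only scalars are killed by all of them. Moreover x ↦
g x conj(g) and x ↦ conj(g) x g preserve vectors. Applied to null vectors of V ⊕ ℝ^{1,1}, this makes
(x c̃ + d̃)(c x + d) a real polynomial in x of degree at most 2, and where it is non-zero, (c x +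
d)⁻¹ is x c̃ + d̃ divided by it. So A(x + h m) - A x depends on h through two real functions only,
which are differentiated by hand. -/

/-! ### Contractions and degree in the exterior algebra. -/

namespace ExteriorAlgebra

variable {K M : Type*} [Field K] [AddCommGroup M] [Module K M]

/-- The Euler operator `∑ i, eᵢ ∧ (eⁱ ⌋ ·)` of a basis `e`. -/
noncomputable def euler {ι : Type*} [Fintype ι] (e : Module.Basis ι K M) :
    ExteriorAlgebra K M →ₗ[K] ExteriorAlgebra K M :=
  ∑ i, LinearMap.mulLeft K (ExteriorAlgebra.ι K (e i)) ∘ₗ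
    CliffordAlgebra.contractLeft (Q := (0 : QuadraticForm K M)) (e.coord i)

theorem euler_apply {ι : Type*} [Fintype ι] (e : Module.Basis ι K M) (a : ExteriorAlgebra K M) :
    euler e a = ∑ i, ExteriorAlgebra.ι K (e i) *
      CliffordAlgebra.contractLeft (Q := (0 : QuadraticForm K M)) (e.coord i) a := by
  simp [euler]

/-- Contraction is an antiderivation; its sign is cancelled by moving `e i` past `m`, and the
leftover terms sum to `m`. -/
theorem euler_ι_mul {ι : Type*} [Fintype ι] (e : Module.Basis ι K M) (m : M)
    (a : ExteriorAlgebra K M) :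
    euler e (ExteriorAlgebra.ι K m * a) =
      ExteriorAlgebra.ι K m * a + ExteriorAlgebra.ι K m * euler e a := by
  have h1 : ∀ i, ExteriorAlgebra.ι K (e i) *
      CliffordAlgebra.contractLeft (Q := (0 : QuadraticForm K M)) (e.coord i)
        (ExteriorAlgebra.ι K m * a) =
      ExteriorAlgebra.ι K (e.repr m i • e i) * a + ExteriorAlgebra.ι K m *
        (ExteriorAlgebra.ι K (e i) *
          CliffordAlgebra.contractLeft (Q := (0 : QuadraticForm K M)) (e.coord i) a) := by
    intro i
    have h2 := CliffordAlgebra.contractLeft_ι_mul (Q := (0 : QuadraticForm K M)) (e.coord i) m a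
    have h3 := ExteriorAlgebra.ι_add_mul_swap (R := K) (e i) m
    change _ * CliffordAlgebra.contractLeft (Q := (0 : QuadraticForm K M)) (e.coord i)
        (CliffordAlgebra.ι 0 m * a) = _
    rw [h2, mul_sub, ← mul_assoc, ← mul_assoc (ExteriorAlgebra.ι K m)]
    rw [← eq_neg_iff_add_eq_zero] at h3
    change _ - (ExteriorAlgebra.ι K (e i) * ExteriorAlgebra.ι K m) * _ = _
    rw [h3]
    simp
  simp only [euler_apply]
  rw [Finset.sum_congr rfl fun i _ => h1 i, Finset.sum_add_distrib, ← Finset.sum_mul, ← map_sum,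
    e.sum_repr, Finset.mul_sum]

theorem euler_of_mem {ι : Type*} [Fintype ι] (e : Module.Basis ι K M) (n : ℕ)
    {a : ExteriorAlgebra K M} (ha : a ∈ ⋀[K]^n M) : euler e a = (n : K) • a := by
  induction ha using Submodule.pow_induction_on_left' with
  | algebraMap r =>
    simp [euler_apply, ExteriorAlgebra, CliffordAlgebra.contractLeft_algebraMap]
  | add x y i hx hy ihx ihy => rw [map_add, ihx, ihy, smul_add]
  | mem_mul m hm i x hx ih =>
    obtain ⟨m, rfl⟩ := hm
    rw [euler_ι_mul, ih]
    push_cast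
    rw [add_smul, one_smul, mul_smul_comm, add_comm]

/-- In characteristic zero, an element all of whose contractions vanish is a scalar. -/
theorem mem_range_algebraMap_of_contractLeft_eq_zero [CharZero K] [FiniteDimensional K M]
    {a : ExteriorAlgebra K M}
    (ha : ∀ d, CliffordAlgebra.contractLeft (Q := (0 : QuadraticForm K M)) d a = 0) :
    ∃ r, a = algebraMap K _ r := by
  classical
  let e := Module.finBasis K M
  let 𝒜 : ℕ → Submodule K (ExteriorAlgebra K M) := fun i => ⋀[K]^i M
  -- The operator is `n` on degree `n`; since it kills `a`, each component of positive degree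
  -- vanishes in characteristic zero.
  have h1 : ∀ (b : ExteriorAlgebra K M) (n : ℕ),
      GradedRing.proj 𝒜 n (euler e b) = (n : K) • GradedRing.proj 𝒜 n b := by
    intro b n
    induction b using DirectSum.Decomposition.inductionOn 𝒜 with
    | zero => simp
    | add x y hx hy => rw [map_add, map_add, hx, hy, map_add, smul_add]
    | @homogeneous i x =>
      rw [euler_of_mem e i x.2, GradedRing.proj_apply, GradedRing.proj_apply,
        DirectSum.decompose_smul, DirectSum.smul_apply, Submodule.coe_smul]
      by_cases h : i = n
      · subst h; rfl
      · rw [DirectSum.decompose_of_mem_ne 𝒜 x.2 h]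
        simp
  have h2 : euler e a = 0 := by simp [euler_apply, ha]
  have h3 : ∀ n, n ≠ 0 → GradedRing.proj 𝒜 n a = 0 := by
    intro n hn
    have := h1 a n
    rw [h2, map_zero, eq_comm, smul_eq_zero] at this
    exact this.resolve_left (by exact_mod_cast hn)
  have h4 : a = GradedRing.proj 𝒜 0 a := by
    conv_lhs => rw [← DirectSum.sum_support_decompose 𝒜 a]
    rw [GradedRing.proj_apply]
    refine Finset.sum_eq_single 0 (fun n _ hn => h3 n hn) fun h => ?_
    simpa using h
  have h5 : a ∈ ⋀[K]^0 M := by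
    rw [h4, GradedRing.proj_apply]
    exact SetLike.coe_mem _
  rw [exteriorPower, pow_zero, Submodule.mem_one] at h5
  obtain ⟨r, hr⟩ := h5
  exact ⟨r, hr.symm⟩

end ExteriorAlgebra

/-! ### The twisted centre of a Clifford algebra. -/

namespace CliffordAlgebra

variable {K M : Type*} [Field K] [AddCommGroup M] [Module K M] {Q : QuadraticForm K M}

theorem mem_range_algebraMap_of_contractLeft_eq_zero [CharZero K] [FiniteDimensional K M]
    {a : CliffordAlgebra Q} (ha : ∀ d, contractLeft d a = 0) : ∃ r, a = algebraMap K _ r := by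
  have : Invertible (2 : K) := invertibleOfNonzero two_ne_zero
  -- `equivExterior` intertwines contractions and fixes scalars.
  obtain ⟨r, hr⟩ := ExteriorAlgebra.mem_range_algebraMap_of_contractLeft_eq_zero
    (a := equivExterior Q a) fun d => by
      have := changeForm_contractLeft (changeForm.associated_neg_proof (Q := Q)) d a
      rw [ha, map_zero] at this
      exact this.symm
  refine ⟨r, (equivExterior Q).injective (hr.trans ?_)⟩
  exact (changeForm_algebraMap (changeForm.associated_neg_proof (Q := Q)) r).symm

/-- The twisted commutator with a vector is a contraction. -/
theorem ι_mul_sub_involute_mul_ι (x : M) (a : CliffordAlgebra Q) :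
    ι Q x * a - involute a * ι Q x = contractLeft (Q.polarBilin x) a := by
  induction a using CliffordAlgebra.left_induction with
  | algebraMap r => simp [contractLeft_algebraMap, Algebra.commutes]
  | add a b ha hb => rw [map_add, map_add, ← ha, ← hb]; noncomm_ring
  | ι_mul y a ha =>
    rw [contractLeft_ι_mul, ← ha, map_mul, involute_ι, ← mul_assoc,
      QuadraticMap.polarBilin_apply_apply, Algebra.smul_def, ← ι_mul_ι_add_swap]
    noncomm_ring

/-- The twisted centre of a nondegenerate Clifford algebra consists of the scalars. -/
theorem mem_range_algebraMap_of_twisted_commute [CharZero K] [FiniteDimensional K M]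
    (hQ : Q.polarBilin.ker = ⊥) {a : CliffordAlgebra Q}
    (ha : ∀ x, ι Q x * a = involute a * ι Q x) : ∃ r, a = algebraMap K _ r := by
  -- By nondegeneracy every functional is polar to a vector, so all contractions are twisted
  -- commutators.
  have hs : Function.Surjective Q.polarBilin :=
    (LinearMap.injective_iff_surjective_of_finrank_eq_finrank
      (Subspace.dual_finrank_eq (K := K) (V := M)).symm).1 (LinearMap.ker_eq_bot.1 hQ)
  refine mem_range_algebraMap_of_contractLeft_eq_zero fun d => ?_
  obtain ⟨x, rfl⟩ := hs d
  rw [← ι_mul_sub_involute_mul_ι, ha, sub_self]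

end CliffordAlgebra

/-! ### Norm, parity and conjugation action of Lipschitz elements. -/

namespace Vahlen

variable {V : Type*} [AddCommGroup V] [Module ℝ V]

section Lipschitz

variable {Q : QuadraticForm ℝ V}

/-- Clifford conjugation, the composition of reversal and grade involution. -/
noncomputable def conj (a : Cl Q) : Cl Q := rev (CliffordAlgebra.involute a)

theorem conj_mul (a b : Cl Q) : conj (a * b) = conj b * conj a := by
  simp [conj, CliffordAlgebra.reverse.map_mul]

theorem conj_vec (v : V) : conj (vec Q v) = -vec Q v := by
  simp [conj]

theorem conj_add (a b : Cl Q) : conj (a + b) = conj a + conj b := by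
  simp [conj]

theorem conj_algebraMap (r : ℝ) : conj (algebraMap ℝ (Cl Q) r) = algebraMap ℝ _ r := by
  simp [conj]

theorem polarBilin_neg_ker_eq_bot (hQ : Q.polarBilin.ker = ⊥) : (-Q).polarBilin.ker = ⊥ := by
  rw [LinearMap.ker_eq_bot'] at hQ ⊢
  intro x hx
  refine hQ x (LinearMap.ext fun y => ?_)
  have := LinearMap.congr_fun hx y
  simpa [QuadraticMap.polar_neg] using this

theorem isUnit_reverse {a : Cl Q} (ha : IsUnit a) : IsUnit (rev a) := by
  obtain ⟨b, h1, h2⟩ := isUnit_iff_exists.1 ha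
  refine isUnit_iff_exists.2 ⟨rev b, ?_, ?_⟩
  · rw [← CliffordAlgebra.reverse.map_mul, h2, CliffordAlgebra.reverse.map_one]
  · rw [← CliffordAlgebra.reverse.map_mul, h1, CliffordAlgebra.reverse.map_one]

/-- A Lipschitz element is invertible up to a non-zero scalar by its conjugate. -/
theorem exists_conj_mul_eq [FiniteDimensional ℝ V] (hQ : Q.polarBilin.ker = ⊥) {g : (Cl Q)ˣ}
    (hg : g ∈ lipschitz Q) :
    ∃ N : ℝ, N ≠ 0 ∧ conj (g : Cl Q) * g = algebraMap ℝ _ N := by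
  have key : ∀ x, ∃ y, (g : Cl Q) * vec Q x = vec Q y * CliffordAlgebra.involute (g : Cl Q) := by
    intro x
    obtain ⟨y, hy⟩ := hg x
    refine ⟨y, ?_⟩
    rw [hy, mul_assoc]
    have : (((gradeInvUnits Q g)⁻¹ : (Cl Q)ˣ) : Cl Q) * CliffordAlgebra.involute (g : Cl Q) = 1 :=
      Units.inv_mul (gradeInvUnits Q g)
    rw [this, mul_one]
  -- Reversing g x = y ĝ gives x g̃ = conj(g) y, so conj(g) g x = conj(g) y ĝ = x g̃ ĝ.
  obtain ⟨N, hN⟩ := CliffordAlgebra.mem_range_algebraMap_of_twisted_commute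
    (polarBilin_neg_ker_eq_bot hQ) (a := CliffordAlgebra.involute (conj (g : Cl Q) * g)) fun x => by
      obtain ⟨y, hy⟩ := key x
      have h2 := congrArg CliffordAlgebra.reverse hy
      rw [CliffordAlgebra.reverse.map_mul, CliffordAlgebra.reverse.map_mul,
        CliffordAlgebra.reverse_ι, CliffordAlgebra.reverse_ι] at h2
      rw [CliffordAlgebra.involute_involute, map_mul, conj, mul_assoc, hy, ← mul_assoc,
        ← mul_assoc, ← h2, CliffordAlgebra.reverse_involute, CliffordAlgebra.involute_involute]
  have hN' : conj (g : Cl Q) * g = algebraMap ℝ _ N := by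
    rw [← CliffordAlgebra.involute_involute (conj (g : Cl Q) * (g : Cl Q)), hN, AlgHom.commutes]
  refine ⟨N, ?_, hN'⟩
  rintro rfl
  have hu : IsUnit (conj (g : Cl Q)) :=
    isUnit_reverse (g.isUnit.map CliffordAlgebra.involute)
  have := hu.mul g.isUnit
  rw [hN', map_zero] at this
  exact not_isUnit_zero this

/-- A Lipschitz element is even or odd. -/
theorem exists_eq_smul_involute [FiniteDimensional ℝ V] (hQ : Q.polarBilin.ker = ⊥) {g : (Cl Q)ˣ}
    (hg : g ∈ lipschitz Q) :
    ∃ k : ℝ, k ≠ 0 ∧ (g : Cl Q) = k • CliffordAlgebra.involute (g : Cl Q) := by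
  set G := gradeInvUnits Q g with hG
  have hGg : CliffordAlgebra.involute (g : Cl Q) = G := rfl
  have hGi : CliffordAlgebra.involute ((g⁻¹ : (Cl Q)ˣ) : Cl Q) = (G⁻¹ : (Cl Q)ˣ) := rfl
  have hGG : CliffordAlgebra.involute (G : Cl Q) = g := by
    rw [← hGg, CliffordAlgebra.involute_involute]
  have hGGi : CliffordAlgebra.involute ((G⁻¹ : (Cl Q)ˣ) : Cl Q) = (g⁻¹ : (Cl Q)ˣ) := by
    rw [← hGi, CliffordAlgebra.involute_involute]
  -- The grade involution negates the vector g x ĝ⁻¹. Hence g⁻¹ĝ lies in the twisted centre.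
  have key : ∀ x, (g : Cl Q) * vec Q x * ((G⁻¹ : (Cl Q)ˣ) : Cl Q) =
      (G : Cl Q) * vec Q x * ((g⁻¹ : (Cl Q)ˣ) : Cl Q) := by
    intro x
    obtain ⟨y, hy⟩ := hg x
    have h2 := congrArg CliffordAlgebra.involute hy
    simp only [map_mul, CliffordAlgebra.involute_ι, ← hG, hGg, hGGi, mul_neg, neg_mul,
      neg_inj] at h2
    rw [← h2, hy]
  obtain ⟨k, hk⟩ := CliffordAlgebra.mem_range_algebraMap_of_twisted_commute
    (polarBilin_neg_ker_eq_bot hQ) (a := ((g⁻¹ : (Cl Q)ˣ) : Cl Q) * G) fun x => by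
      have h1 := congrArg (fun z => ((G⁻¹ : (Cl Q)ˣ) : Cl Q) * z * G) (key x)
      simp only [mul_assoc, Units.inv_mul, mul_one, Units.inv_mul_cancel_left] at h1
      rw [map_mul, hGi, hGG, mul_assoc, h1]
  have hk0 : k ≠ 0 := by
    rintro rfl
    have := (g⁻¹ * G).isUnit
    rw [Units.val_mul, hk, map_zero] at this
    exact not_isUnit_zero this
  refine ⟨k⁻¹, inv_ne_zero hk0, ?_⟩
  rw [eq_inv_smul_iff₀ hk0, hGg, ← Units.mul_inv_cancel_left g (G : Cl Q), hk, Algebra.smul_def,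
    Algebra.commutes]

/-- Conjugation by a Lipschitz element preserves the vectors, in both directions. -/
theorem exists_vec_eq_conj [FiniteDimensional ℝ V] (hQ : Q.polarBilin.ker = ⊥) {g : (Cl Q)ˣ}
    (hg : g ∈ lipschitz Q) :
    ∃ N : ℝ, N ≠ 0 ∧ conj (g : Cl Q) * g = algebraMap ℝ _ N ∧
      (g : Cl Q) * conj (g : Cl Q) = algebraMap ℝ _ N ∧
      (∀ x, ∃ y, (g : Cl Q) * vec Q x * conj (g : Cl Q) = vec Q y) ∧
      (∀ x, ∃ y, conj (g : Cl Q) * vec Q x * g = vec Q y) := by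
  obtain ⟨N, hN, h1⟩ := exists_conj_mul_eq hQ hg
  obtain ⟨k, hk, h2⟩ := exists_eq_smul_involute hQ hg
  have h3 : conj (g : Cl Q) = N • ((g⁻¹ : (Cl Q)ˣ) : Cl Q) := by
    rw [← Units.mul_inv_cancel_right (conj (g : Cl Q)) g, h1, Algebra.smul_def]
  have h4 : (g : Cl Q) * conj (g : Cl Q) = algebraMap ℝ _ N := by
    rw [h3, mul_smul_comm, Units.mul_inv, Algebra.algebraMap_eq_smul_one]
  -- As g is a multiple of ĝ, conj(g) is a multiple of ĝ⁻¹ too, so x ↦ g x conj(g) is the twisted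
  -- action rescaled.
  have h5 : CliffordAlgebra.involute (g : Cl Q) * conj (g : Cl Q) = algebraMap ℝ _ (k⁻¹ * N) := by
    rw [← inv_smul_eq_iff₀ hk] at h2
    rw [← h2, smul_mul_assoc, h4, Algebra.smul_def, map_mul]
  have h6 : conj (g : Cl Q) = (k⁻¹ * N) • ((gradeInvUnits Q g)⁻¹ : (Cl Q)ˣ) := by
    change ((gradeInvUnits Q g : (Cl Q)ˣ) : Cl Q) * _ = _ at h5
    rw [← Units.inv_mul_cancel_left (gradeInvUnits Q g) (conj (g : Cl Q)), h5,
      ← Algebra.commutes, Algebra.smul_def]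
  have h7 : ∀ x, ∃ y, (g : Cl Q) * vec Q x * conj (g : Cl Q) = vec Q y := by
    intro x
    obtain ⟨y, hy⟩ := hg x
    exact ⟨(k⁻¹ * N) • y, by rw [h6, mul_smul_comm, map_smul, hy]⟩
  refine ⟨N, hN, h1, h4, h7, fun x => ?_⟩
  -- `f` maps the vectors injectively into themselves, hence onto by finite dimension; the opposite
  -- conjugation inverts it up to N².
  let f : Cl Q →ₗ[ℝ] Cl Q :=
    LinearMap.mulRight ℝ (conj (g : Cl Q)) ∘ₗ LinearMap.mulLeft ℝ (g : Cl Q)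
  have hf : ∀ a, conj (g : Cl Q) * f a * g = (N * N) • a := by
    intro a
    have : conj (g : Cl Q) * f a * g =
        (conj (g : Cl Q) * g) * a * (conj (g : Cl Q) * g) := by
      simp only [f, LinearMap.comp_apply, LinearMap.mulLeft_apply, LinearMap.mulRight_apply,
        mul_assoc]
    rw [this, h1, ← Algebra.commutes, ← mul_assoc, ← map_mul, Algebra.smul_def]
  have hfi : Function.Injective f := by
    intro a b hab
    have h8 := hf a
    rw [hab, hf b] at h8
    exact (smul_right_injective _ (mul_ne_zero hN hN) h8).symm
  have hle : (LinearMap.range (vec Q)).map f ≤ LinearMap.range (vec Q) := by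
    rintro _ ⟨_, ⟨x, rfl⟩, rfl⟩
    obtain ⟨y, hy⟩ := h7 x
    exact ⟨y, hy.symm⟩
  have heq := Submodule.eq_of_le_of_finrank_eq hle 
    (Submodule.equivMapOfInjective f hfi _).finrank_eq.symm
  obtain ⟨_, ⟨z, rfl⟩, hz⟩ : vec Q x ∈ (LinearMap.range (vec Q)).map f := by
    rw [heq]; exact ⟨x, rfl⟩
  exact ⟨(N * N) • z, by rw [← hz, hf, map_smul]⟩

end Lipschitz

/-! ### Transfer to 2 × 2 matrices. -/

variable {Q : QuadraticForm ℝ V}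

/-- Clifford conjugation of `Cl(V ⊕ ℝ^{1,1})` in terms of matrices. -/
noncomputable def matConj (A : Matrix (Fin 2) (Fin 2) (Cl Q)) : Matrix (Fin 2) (Fin 2) (Cl Q) :=
  !![rev (A 1 1), -rev (A 0 1); -rev (A 1 0), rev (A 0 0)]

theorem matConj_mul (A B : Matrix (Fin 2) (Fin 2) (Cl Q)) :
    matConj (A * B) = matConj B * matConj A := by
  ext a b
  fin_cases a <;> fin_cases b <;>
    simp [matConj, Matrix.mul_apply, Fin.sum_univ_two, CliffordAlgebra.reverse.map_mul] <;> abel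

theorem jHat_vec (w : V × ℝ × ℝ) : jHat Q (vec (hatQ Q) w) = j Q w :=
  CliffordAlgebra.lift_ι_apply _ _ _

/-- Both conjugations reverse products, so agreement on scalars and vectors suffices. -/
theorem jHat_conj (g : Cl (hatQ Q)) : jHat Q (conj g) = matConj (jHat Q g) := by
  induction g using CliffordAlgebra.induction with
  | algebraMap r =>
    rw [conj_algebraMap, AlgHom.commutes]
    ext a b
    fin_cases a <;> fin_cases b <;> simp [matConj, Matrix.algebraMap_matrix_apply]
  | ι w =>
    rw [conj_vec, map_neg, jHat_vec]
    ext a b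
    fin_cases a <;> fin_cases b <;> simp [matConj, j]
  | mul a b ha hb => rw [conj_mul, map_mul, map_mul, ha, hb, matConj_mul]
  | add a b ha hb =>
    rw [conj_add, map_add, map_add, ha, hb]
    ext a b
    fin_cases a <;> fin_cases b <;> simp [matConj] <;> abel

theorem hatQ_polarBilin_ker_eq_bot (hQ : Q.polarBilin.ker = ⊥) :
    (hatQ Q).polarBilin.ker = ⊥ := by
  rw [LinearMap.ker_eq_bot'] at hQ ⊢
  rintro ⟨v, s, t⟩ h
  have h' : ∀ w, QuadraticMap.polar (hatQ Q) (v, s, t) w = 0 := fun w => LinearMap.congr_fun h w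
  have hv : v = 0 := by
    refine hQ v (LinearMap.ext fun y => ?_)
    have := h' (y, 0, 0)
    simp only [QuadraticMap.polar, Prod.mk_add_mk, hatQ_apply] at this
    simp only [QuadraticMap.polarBilin_apply_apply, QuadraticMap.polar, LinearMap.zero_apply]
    linarith
  have hs := h' (0, 1, 0)
  have ht := h' (0, 0, 1)
  simp only [QuadraticMap.polar, Prod.mk_add_mk, hatQ_apply, add_zero, QuadraticMap.map_zero]
    at hs ht
  have hs' : s = 0 := by linarith
  have ht' : t = 0 := by linarith
  rw [hv, hs', ht']
  rfl

theorem IsVahlen.exists_matConj [FiniteDimensional ℝ V] (hQ : Q.polarBilin.ker = ⊥)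
    {A : Matrix (Fin 2) (Fin 2) (Cl Q)} (hA : IsVahlen Q A) :
    ∃ N : ℝ, matConj A * A = algebraMap ℝ _ N ∧ A * matConj A = algebraMap ℝ _ N ∧
      (∀ w, ∃ w', A * j Q w * matConj A = j Q w') ∧
      (∀ w, ∃ w', matConj A * j Q w * A = j Q w') := by
  obtain ⟨g, hg, rfl⟩ := hA
  obtain ⟨N, -, h1, h2, h3, h4⟩ := exists_vec_eq_conj (hatQ_polarBilin_ker_eq_bot hQ) hg
  refine ⟨N, ?_, ?_, fun w => ?_, fun w => ?_⟩
  · rw [← jHat_conj, ← map_mul, h1, AlgHom.commutes]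
  · rw [← jHat_conj, ← map_mul, h2, AlgHom.commutes]
  · obtain ⟨y, hy⟩ := h3 w
    exact ⟨y, by rw [← jHat_conj, ← jHat_vec, ← jHat_vec, ← map_mul, ← map_mul, hy]⟩
  · obtain ⟨y, hy⟩ := h4 w
    exact ⟨y, by rw [← jHat_conj, ← jHat_vec, ← jHat_vec, ← map_mul, ← map_mul, hy]⟩

end Vahlen

/-! ### Denominators and the difference formula. -/

namespace Vahlen

variable {V : Type*} [AddCommGroup V] [Module ℝ V] {Q : QuadraticForm ℝ V}

theorem rev_den (A : Matrix (Fin 2) (Fin 2) (Cl Q)) (x : V) : rev (den A x) = denRev A x := by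
  simp [den, denRev, CliffordAlgebra.reverse.map_mul]

theorem vec_mul_self (x : V) : vec Q x * vec Q x = -algebraMap ℝ (Cl Q) (Q x) := by
  simp [vec]

/-- The row `(c, d)` of a Vahlen matrix has `c̃c` and `d̃d` real and `d̃c = c̃d` in `V`. -/
theorem exists_row_norms {A : Matrix (Fin 2) (Fin 2) (Cl Q)}
    (h : ∀ w, ∃ w', matConj A * j Q w * A = j Q w') :
    ∃ (γ δ : ℝ) (v : V), rev (A 1 0) * A 1 0 = algebraMap ℝ _ γ ∧
      rev (A 1 1) * A 1 1 = algebraMap ℝ _ δ ∧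
      rev (A 1 1) * A 1 0 = vec Q v ∧ rev (A 1 0) * A 1 1 = vec Q v := by
  -- This null vector is a matrix unit; its conjugate is the column (d̃, -c̃) times the row (c, d).
  obtain ⟨⟨v, s, t⟩, hw⟩ := h (0, 1 / 2, -1 / 2)
  have hj : j Q (0, 1 / 2, -1 / 2) = !![0, 1; 0, 0] := by
    ext a b
    fin_cases a <;> fin_cases b <;> simp [j] <;> norm_num [← map_sub, ← map_add]
  rw [hj] at hw
  have h00 := congrFun (congrFun hw 0) 0
  have h01 := congrFun (congrFun hw 0) 1
  have h10 := congrFun (congrFun hw 1) 0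
  have h11 := congrFun (congrFun hw 1) 1
  simp only [matConj, j, Matrix.mul_apply, Fin.sum_univ_two, Matrix.of_apply, Matrix.cons_val',
    Matrix.cons_val_zero, Matrix.cons_val_one, Matrix.cons_val_fin_one, mul_zero, mul_one, add_zero,
    zero_add, zero_mul, neg_zero, LinearMap.coe_mk, AddHom.coe_mk, neg_mul, neg_inj] at h00 h01 h10 h11
  exact ⟨-(s + t), s - t, v, by rw [map_neg, ← h10, neg_neg], h01, h00, h11⟩

theorem exists_den_mul_denRev {A : Matrix (Fin 2) (Fin 2) (Cl Q)}
    (h : ∀ w, ∃ w', A * j Q w * matConj A = j Q w') (x : V) :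
    ∃ r : ℝ, den A x * denRev A x = algebraMap ℝ _ r := by
  -- This null vector is the column (x, 1) times the row (1, -x), so its conjugate has lower left
  -- entry (c x + d)(x c̃ + d̃).
  obtain ⟨⟨v, s, t⟩, hw⟩ := h (x, (1 + Q x) / 2, (1 - Q x) / 2)
  have hj : j Q (x, (1 + Q x) / 2, (1 - Q x) / 2) =
      !![vec Q x, -(vec Q x * vec Q x); 1, -vec Q x] := by
    have h1 : (1 + Q x) / 2 - (1 - Q x) / 2 = Q x := by ring
    have h2 : (1 + Q x) / 2 + (1 - Q x) / 2 = 1 := by ring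
    simp only [j, LinearMap.coe_mk, AddHom.coe_mk, h1, h2, vec_mul_self, neg_neg, map_one]
  rw [hj] at hw
  have h10 := congrFun (congrFun hw 1) 0
  simp only [matConj, j, Matrix.mul_apply, Fin.sum_univ_two, Matrix.of_apply, Matrix.cons_val',
    Matrix.cons_val_zero, Matrix.cons_val_one, Matrix.cons_val_fin_one, mul_one,
    LinearMap.coe_mk, AddHom.coe_mk] at h10
  refine ⟨s + t, h10.symm.trans ?_ |>.symm⟩
  simp only [den, denRev]
  noncomm_ring

theorem denRev_mul_den {A : Matrix (Fin 2) (Fin 2) (Cl Q)} {γ δ : ℝ} {v : V}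
    (hγ : rev (A 1 0) * A 1 0 = algebraMap ℝ _ γ) (hδ : rev (A 1 1) * A 1 1 = algebraMap ℝ _ δ)
    (hv : rev (A 1 1) * A 1 0 = vec Q v) (hv' : rev (A 1 0) * A 1 1 = vec Q v) (x : V) :
    denRev A x * den A x =
      algebraMap ℝ _ (δ - γ * Q x - QuadraticMap.polar Q x v) := by
  have h1 : vec Q x * vec Q v + vec Q v * vec Q x =
      -algebraMap ℝ (Cl Q) (QuadraticMap.polar Q x v) := by
    rw [vec, CliffordAlgebra.ι_mul_ι_add_swap, FunLike.coe_neg, QuadraticMap.polar_neg, map_neg]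
  have h2 : denRev A x * den A x = vec Q x * (rev (A 1 0) * A 1 0) * vec Q x +
      (vec Q x * (rev (A 1 0) * A 1 1) + rev (A 1 1) * A 1 0 * vec Q x) +
      rev (A 1 1) * A 1 1 := by
    simp only [den, denRev]
    noncomm_ring
  rw [h2, hγ, hδ, hv, hv', h1, ← Algebra.commutes, mul_assoc, vec_mul_self]
  simp only [map_sub, map_mul]
  noncomm_ring

/-- Associativity of `q * p * q` forces `s = r`, so `p` is a two-sided inverse up to scale. -/
theorem isUnit_of_mul_eq_algebraMap {R : Type*} [Ring R] [Algebra ℝ R] {p q : R} {r s : ℝ}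
    (hr : r ≠ 0) (hpq : p * q = algebraMap ℝ R r) (hqp : q * p = algebraMap ℝ R s) :
    IsUnit q ∧ Ring.inverse q = r⁻¹ • p := by
  nontriviality R
  have hq : q ≠ 0 := by
    rintro rfl
    rw [mul_zero, eq_comm, FaithfulSMul.algebraMap_eq_zero_iff] at hpq
    exact hr hpq
  have hsr : s = r := by
    have h : s • q = r • q := by
      rw [Algebra.smul_def, ← hqp, mul_assoc, hpq, ← Algebra.commutes, Algebra.smul_def]
    exact smul_left_injective ℝ hq h
  subst hsr
  have h1 : q * (s⁻¹ • p) = 1 := by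
    rw [mul_smul_comm, hqp, Algebra.algebraMap_eq_smul_one, inv_smul_smul₀ hr]
  have h2 : (s⁻¹ • p) * q = 1 := by
    rw [smul_mul_assoc, hpq, Algebra.algebraMap_eq_smul_one, inv_smul_smul₀ hr]
  exact ⟨isUnit_iff_exists.2 ⟨_, h1, h2⟩, Ring.inverse_unit ⟨q, s⁻¹ • p, h1, h2⟩⟩

theorem act_sub_act {A : Matrix (Fin 2) (Fin 2) (Cl Q)} {N : ℝ}
    (hCA : matConj A * A = algebraMap ℝ _ N) (hAC : A * matConj A = algebraMap ℝ _ N)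
    {x y : V} (hx : IsUnit (den A x)) (hy : IsUnit (den A y)) :
    act A x - act A y = pdet A * Ring.inverse (denRev A y) * vec Q (x - y) *
      Ring.inverse (den A x) := by
  have hy' : IsUnit (denRev A y) := rev_den A y ▸ isUnit_reverse hy
  have hN : pdet A = algebraMap ℝ _ N := by
    have := congrFun (congrFun hAC 0) 0
    simp only [matConj, Matrix.mul_apply, Fin.sum_univ_two, Matrix.of_apply, Matrix.cons_val',
      Matrix.cons_val_zero, Matrix.cons_val_one, Matrix.cons_val_fin_one, mul_neg,
      Matrix.algebraMap_matrix_apply, if_true] at this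
    rw [pdet, sub_eq_add_neg, this]
  have h00 := congrFun (congrFun hCA 0) 0
  have h01 := congrFun (congrFun hCA 0) 1
  have h10 := congrFun (congrFun hCA 1) 0
  have h11 := congrFun (congrFun hCA 1) 1
  simp only [matConj, Matrix.mul_apply, Fin.sum_univ_two, Matrix.of_apply, Matrix.cons_val',
      Matrix.cons_val_zero, Matrix.cons_val_one, Matrix.cons_val_fin_one, neg_mul,
      Matrix.algebraMap_matrix_apply, if_true, one_ne_zero, zero_ne_one, if_false]
    at h00 h01 h10 h11
  have key : ∀ z : V, denRev A y * (A 0 0 * vec Q z + A 0 1) -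
      (vec Q y * rev (A 0 0) + rev (A 0 1)) * den A z = algebraMap ℝ _ N * vec Q (z - y) := by
    intro z
    have e : denRev A y * (A 0 0 * vec Q z + A 0 1) -
        (vec Q y * rev (A 0 0) + rev (A 0 1)) * den A z =
        -(vec Q y * (-(rev (A 1 0) * A 0 0) + rev (A 0 0) * A 1 0) * vec Q z) -
        vec Q y * (-(rev (A 1 0) * A 0 1) + rev (A 0 0) * A 1 1) +
        (rev (A 1 1) * A 0 0 + -(rev (A 0 1) * A 1 0)) * vec Q z +
        (rev (A 1 1) * A 0 1 + -(rev (A 0 1) * A 1 1)) := by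
      simp only [den, denRev]
      noncomm_ring
    rw [e, h00, h01, h10, h11, ← Algebra.commutes, map_sub]
    noncomm_ring
  -- The case z = y of `key` rewrites A y as a left fraction, ready to be subtracted from the right
  -- fraction A x.
  have hact : act A y = Ring.inverse (denRev A y) * (vec Q y * rev (A 0 0) + rev (A 0 1)) := by
    have h := key y
    rw [sub_self, map_zero, mul_zero, sub_eq_zero] at h
    rw [act, ← Ring.inverse_mul_cancel_left _ (A 0 0 * vec Q y + A 0 1) hy', h, mul_assoc,
      mul_assoc, Ring.mul_inverse_cancel _ hy, mul_one]
  have hactx : act A x = Ring.inverse (denRev A y) *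
      (denRev A y * (A 0 0 * vec Q x + A 0 1)) * Ring.inverse (den A x) := by
    rw [Ring.inverse_mul_cancel_left _ _ hy', act]
  rw [← Ring.mul_inverse_cancel_right _ (act A y) hx, hactx, hact, ← sub_mul, mul_assoc _ _
    (den A x), ← mul_sub, key, hN, ← mul_assoc, Algebra.commutes]

end Vahlen

/-! ### The derivative. -/

/-- An affine function of a differentiable function is differentiable, in topological vector
spaces. -/
theorem HasDerivAt.affine_comp {𝕜 E F : Type*} [NontriviallyNormedField 𝕜] [AddCommGroup E]
    [Module 𝕜 E] [TopologicalSpace E] [ContinuousSMul 𝕜 E] [AddCommGroup F] [Module 𝕜 F]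
    [TopologicalSpace F] [ContinuousSMul 𝕜 F] {φ : 𝕜 → E} {φ' : E} {x : 𝕜}
    (hφ : HasDerivAt φ φ' x) (L : E →L[𝕜] F) (c : F) {f : 𝕜 → F}
    (hf : ∀ᶠ t in 𝓝 x, f t = c + L (φ t)) : HasDerivAt f (L φ') x := by
  have h1 := hasFDerivAt_iff_isLittleOTVS.1 hφ
  refine hasFDerivAt_iff_isLittleOTVS.2
    (((L.isBigOTVS_fun_comp).trans_isLittleOTVS h1).congr' ?_ Filter.EventuallyEq.rfl)
  filter_upwards [hf] with t ht
  rw [ht, hf.self_of_nhds]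
  simp

namespace Vahlen

variable {V : Type*} [AddCommGroup V] [Module ℝ V] {Q : QuadraticForm ℝ V}

theorem denRev_add (A : Matrix (Fin 2) (Fin 2) (Cl Q)) (x y : V) :
    denRev A (x + y) = denRev A x + vec Q y * rev (A 1 0) := by
  simp only [denRev, map_add]
  noncomm_ring

end Vahlen

open Vahlen in
theorem mainTheorem6 {V : Type*} [AddCommGroup V] [Module ℝ V] [FiniteDimensional ℝ V]
    (Q : QuadraticForm ℝ V) (hQ : Q.Nondegenerate)
    (A : Matrix (Fin 2) (Fin 2) (Vahlen.Cl Q)) (hA : Vahlen.IsVahlen Q A) :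
    (∀ x y : V, IsUnit (Vahlen.den A x) → IsUnit (Vahlen.den A y) →
      Vahlen.act A x - Vahlen.act A y =
          Vahlen.pdet A * Ring.inverse (Vahlen.denRev A y) * Vahlen.vec Q (x - y) *
            Ring.inverse (Vahlen.den A x) ∧
      Vahlen.act A x - Vahlen.act A y =
          Vahlen.pdet A * Ring.inverse (Vahlen.denRev A x) * Vahlen.vec Q (x - y) *
            Ring.inverse (Vahlen.den A y)) ∧
    (∀ (n : ℕ) (e : Module.Basis (Fin n) ℝ V) (μ : Fin n) (x : V), IsUnit (Vahlen.den A x) →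
      (∀ᶠ h : ℝ in 𝓝 0, IsUnit (Vahlen.den A (x + h • e μ))) ∧
      HasDerivAt (fun h : ℝ => Vahlen.act A (x + h • e μ))
        (Vahlen.pdet A * Ring.inverse (Vahlen.denRev A x) * Vahlen.vec Q (e μ) *
          Ring.inverse (Vahlen.den A x)) 0 ∧
      ∃ r : ℝ, r ≠ 0 ∧ Vahlen.denRev A x * Vahlen.den A x = algebraMap ℝ (Vahlen.Cl Q) r ∧
        HasDerivAt (fun h : ℝ => Vahlen.act A (x + h • e μ))
          (r⁻¹ • (Vahlen.pdet A * Vahlen.den A x * Vahlen.vec Q (e μ) *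
            Ring.inverse (Vahlen.den A x))) 0) := by
  have hQ' : Q.polarBilin.ker = ⊥ := by
    have : Invertible (2 : ℝ) := invertibleOfNonzero two_ne_zero
    rw [← QuadraticMap.radical_eq_ker_polarBilin, hQ.radical_eq_bot]
  obtain ⟨N, hCA, hAC, hAw, hwA⟩ := hA.exists_matConj hQ'
  refine ⟨fun x y hx hy => ⟨act_sub_act hCA hAC hx hy, ?_⟩, fun n e μ x hx => ?_⟩
  · rw [← neg_sub, act_sub_act hCA hAC hy hx, ← neg_sub x y, map_neg, mul_neg, neg_mul, neg_neg]
  obtain ⟨γ, δ, v, hγ, hδ, hv, hv'⟩ := exists_row_norms hwA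
  set m := e μ
  let r : V → ℝ := fun y => δ - γ * Q y - QuadraticMap.polar Q y v
  have hr : ∀ y, denRev A y * den A y = algebraMap ℝ _ (r y) := denRev_mul_den hγ hδ hv hv'
  have hinv : ∀ y, r y ≠ 0 →
      IsUnit (den A y) ∧ Ring.inverse (den A y) = (r y)⁻¹ • denRev A y := fun y hy =>
    let ⟨_, hs⟩ := exists_den_mul_denRev hAw y
    isUnit_of_mul_eq_algebraMap hy (hr y) hs
  have hx' : IsUnit (denRev A x) := rev_den A x ▸ isUnit_reverse hx
  have hrx : r x ≠ 0 := by
    intro h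
    have := hx'.mul hx
    rw [hr, h, map_zero] at this
    exact not_isUnit_zero this
  let ρ : ℝ → ℝ := fun h => r (x + h • m)
  have hρ : ∀ h, ρ h = r x - (γ * QuadraticMap.polar Q x m + QuadraticMap.polar Q m v) * h -
      γ * Q m * h ^ 2 := by
    intro h
    simp only [ρ, r, QuadraticMap.map_add Q x (h • m), QuadraticMap.polar_add_left,
      QuadraticMap.polar_smul_left, QuadraticMap.polar_smul_right, QuadraticMap.map_smul,
      smul_eq_mul]
    ring
  have hρd : DifferentiableAt ℝ ρ 0 := by
    rw [funext hρ]
    fun_prop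
  have hρ0 : ρ 0 = r x := by simp [ρ]
  have hev : ∀ᶠ h : ℝ in 𝓝 0, ρ h ≠ 0 := hρd.continuousAt.eventually_ne (hρ0 ▸ hrx)
  let P := pdet A * Ring.inverse (denRev A x) * vec Q m
  have : ContinuousAdd (Cl Q) := IsModuleTopology.toContinuousAdd ℝ (Cl Q)
  -- With (c(x + h m) + d)⁻¹ = ρ(h)⁻¹ (x c̃ + d̃ + h m c̃), the increment of A is `L` at (h/ρ,
  -- h²/ρ). The module topology makes `L` continuous without a norm on `Cl Q`.
  let L : ℝ × ℝ →L[ℝ] Cl Q :=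
    ⟨(LinearMap.fst ℝ ℝ ℝ).smulRight (P * denRev A x) +
      (LinearMap.snd ℝ ℝ ℝ).smulRight (P * (vec Q m * rev (A 1 0))),
      IsModuleTopology.continuous_of_linearMap _⟩
  have hL : ∀ p, L p = p.1 • (P * denRev A x) + p.2 • (P * (vec Q m * rev (A 1 0))) :=
    fun _ => rfl
  have hφ : HasDerivAt (fun h : ℝ => (h * (ρ h)⁻¹, h * (h * (ρ h)⁻¹))) ((r x)⁻¹, (0 : ℝ)) 0 := by
    have h1 := hρd.hasDerivAt.inv (hρ0 ▸ hrx)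
    have h2 := (hasDerivAt_id (0 : ℝ)).mul h1
    have h3 := (hasDerivAt_id (0 : ℝ)).mul h2
    convert h2.prodMk h3 using 1
    · ext <;> simp
    · simp [hρ0]
  have hd := hφ.affine_comp L (act A x) (f := fun h => act A (x + h • m)) <| by
    filter_upwards [hev] with h hh
    obtain ⟨hu, hi⟩ := hinv _ hh
    rw [← sub_eq_iff_eq_add', act_sub_act hCA hAC hu hx, hi, denRev_add, add_sub_cancel_left, hL]
    simp only [map_smul, P, mul_add, smul_add, mul_smul_comm, smul_mul_assoc, smul_smul, ρ]
    rw [mul_comm _ h, mul_comm _ h]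
  have hval : L ((r x)⁻¹, 0) = P * Ring.inverse (den A x) := by
    rw [hL, zero_smul, add_zero, (hinv x hrx).2, mul_smul_comm]
  rw [hval] at hd
  refine ⟨hev.mono fun h hh => (hinv _ hh).1, hd, r x, hrx, hr x, ?_⟩
  convert hd using 1
  have : Ring.inverse (denRev A x) = (r x)⁻¹ • den A x := by
    rw [eq_inv_smul_iff₀ hrx, ← Ring.inverse_mul_cancel_left _ (den A x) hx', hr, Algebra.smul_def,
      Algebra.commutes]
  simp only [P]
  rw [this]
  simp only [mul_smul_comm, smul_mul_assoc]
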